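/- Let $K$ be a non-archimedean local field with absolute value $|\cdot|$ and let $V$ be a finite-dimensional $K$-vector space of dimension $n$. A *seminorm* on $V$ is a map $\gamma: V\to\mathbb{R}_{\ge 0}$, not identically zero, with $\gamma(\lambda v)=|\lambda|\gamma(v)$ and $\gamma(v+w)\le\max\{\gamma(v),\gamma(w)\}$; it is a *norm* if $\gamma(v)>0$ for all $v\neq 0$. Two seminorms are equivalent if they differ by a positive constant factor. Let $\overline X$ be the set of equivalence classes of seminorms on $V$, with the quotient topology of the topology of pointwise convergence, and let $X\subseteq\overline X$ (the building of $PGL(V)$) be the subset of classes of norms. A seminorm $\gamma$ is *canonical* with respect to a basis $w_1,\dots,w_n$ of $V$ if $\gamma(\sum_i\lambda_iw_i)=\max_i|\lambda_i|\gamma(w_i)$ for all $\lambda_i\in K$. Let $\mathbb{P}(V)^{an}$ be the Berkovich projective space of $\mathbb{P}(V)=\mathrm{Proj}\,\mathrm{Sym}\,V$, that is, the set of equivalence classes of multiplicative (ultrametric) seminorms on $\mathrm{Sym}\,V$ which extend the absolute value of $K$ and do not vanish identically on $V$, where $\alpha\sim\beta$ if there is $c>0$ with $\alpha(f)=c^d\beta(f)$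 for all $d$ and all homogeneous $f$ of degree $d$; its topology is the quotient topology of the topology of pointwise convergence. Let $\Omega^{an}\subseteq\mathbb{P}(V)^{an}$ be the complement of the union of all $K$-rational hyperplanes. The group $PGL(V)=GL(V)/K^\times$ acts on $\overline X$ by $g[\gamma]=[\gamma\circ g^{-1}]$ and on $\mathbb{P}(V)^{an}$ by $g[\alpha]=[\alpha\circ\mathrm{Sym}(g^{-1})]$. 1. The map $r:\mathbb{P}(V)^{an}\to\overline X$, $r([\alpha])=[\alpha|_V]$, is continuous and $PGL(V)$-equivariant. It extends Berkovich's reduction map $\Omega^{an}\to X$, which maps $[\alpha]$ to the class of the norm $\alpha|_V$, and Drinfeld's reduction map, which maps a $\overline K$-rational point of $\Omega$, given by the line of a $K$-linear map $z:V\to\overline K$ with $z(v)\neq0$ for all $v\ne0$, to the class of the norm $v\mapsto|z(v)|$; the point of $\mathbb{P}(V)^{an}$ defined by such a $z$, namely the class of $f\mapsto|f(z)|$, lies in $\Omega^{an}$. 2. Every seminorm on $V$ is canonical with respect to some basis, and there is a well-defined map $j:\overline X\to\mathbb{P}(V)^{an}$ which maps the class of a seminorm $\gamma$ to the class of $$\alpha\Big(\sum_\nu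 a_\nu w_1^{\nu_1}\cdots w_n^{\nu_n}\Big)=\max_\nu |a_\nu|\,\gamma(w_1)^{\nu_1}\cdots\gamma(w_n)^{\nu_n}$$ for any basis $w_1,\dots,w_n$ with respect to which $\gamma$ is canonical; here $\alpha$ is a multiplicative seminorm on $\mathrm{Sym}\,V$ of the kind considered above. 3. The map $j$ is continuous and $PGL(V)$-equivariant, $r\circ j=\mathrm{id}_{\overline X}$, and $j$ is a homeomorphism from $\overline X$ onto its image, which is a closed subset of $\mathbb{P}(V)^{an}$. -/

import Mathlib

open scoped NNReal LinearAlgebra.Projectivization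

noncomputable section

namespace SeminormCompactification

variable (K : Type*) [NontriviallyNormedField K]
variable (V : Type*) [AddCommGroup V] [Module K V]

/-! ### Seminorms on `V` and the space `X̄` of their homothety classes -/

/-- A (non-archimedean, not identically zero) seminorm on the `K`-vector space `V`. -/
structure VectorSeminorm where
  toFun : V → ℝ≥0
  map_smul' : ∀ (a : K) (v : V), toFun (a • v) = ‖a‖₊ * toFun v
  map_add_le_max' : ∀ v w : V, toFun (v + w) ≤ max (toFun v) (toFun w)
  exists_ne_zero' : ∃ v : V, toFun v ≠ 0

instance : FunLike (VectorSeminorm K V) V ℝ≥0 where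
  coe := VectorSeminorm.toFun
  coe_injective γ δ h := by cases γ; cases δ; congr

/-- The topology of pointwise convergence on the set of all seminorms on `V`. -/
instance : TopologicalSpace (VectorSeminorm K V) :=
  TopologicalSpace.induced (fun γ => (γ : V → ℝ≥0)) inferInstance

/-- Two seminorms are equivalent if they differ by a positive constant factor. -/
instance vectorSetoid : Setoid (VectorSeminorm K V) where
  r γ δ := ∃ c : ℝ≥0, 0 < c ∧ ∀ v, γ v = c * δ v
  iseqv :=
    { refl := fun γ => ⟨1, one_pos, fun v => (one_mul _).symm⟩
      symm := by
        rintro γ δ ⟨c, hc, h⟩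
        exact ⟨c⁻¹, inv_pos.2 hc, fun v => by rw [h, inv_mul_cancel_left₀ hc.ne']⟩
      trans := by
        rintro γ δ ε ⟨c, hc, h⟩ ⟨d, hd, h'⟩
        exact ⟨c * d, mul_pos hc hd, fun v => by rw [h, h', mul_assoc]⟩ }

/-- `X̄`: the set of homothety classes of seminorms on `V`. -/
def XBar : Type _ := Quotient (vectorSetoid K V)

/-- `X̄` carries the quotient topology of the topology of pointwise convergence. -/
instance : TopologicalSpace (XBar K V) :=
  inferInstanceAs (TopologicalSpace (Quotient (vectorSetoid K V)))

variable {K V}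

/-- The point of `X̄` represented by a seminorm. -/
def XBar.mk (γ : VectorSeminorm K V) : XBar K V := Quotient.mk (vectorSetoid K V) γ

/-- A seminorm is a norm if it is nonzero at all nonzero vectors. -/
def VectorSeminorm.IsNorm (γ : VectorSeminorm K V) : Prop := ∀ v : V, v ≠ 0 → γ v ≠ 0

/-- `γ` is canonical with respect to the basis `b`, i.e.
`γ(∑ cᵢ bᵢ) = sup |cᵢ| γ(bᵢ)` for all scalars `cᵢ`. -/
def VectorSeminorm.IsCanonical (γ : VectorSeminorm K V) {κ : Type*} [Fintype κ]
    (b : Module.Basis κ K V) : Prop :=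
  ∀ c : κ → K, γ (∑ i, c i • b i) = Finset.univ.sup fun i => ‖c i‖₊ * γ (b i)

variable (K V)

/-- The building `X`, as the subset of `X̄` of all classes of norms. -/
def building : Set (XBar K V) := {x | ∃ γ : VectorSeminorm K V, γ.IsNorm ∧ XBar.mk γ = x}

/-! ### The Berkovich projective space `ℙ(V)^an` -/

/-- A multiplicative (ultrametric) seminorm on `Sym V` which extends the absolute value of `K`
and does not vanish identically on `V`. -/
structure PolySeminorm extends Valuation (SymmetricAlgebra K V) ℝ≥0 where
  map_algebraMap' : ∀ a : K, toFun (algebraMap K (SymmetricAlgebra K V) a) = ‖a‖₊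
  exists_ne_zero' : ∃ v : V, toFun (SymmetricAlgebra.ι K V v) ≠ 0

instance : CoeFun (PolySeminorm K V) (fun _ => SymmetricAlgebra K V → ℝ≥0) where
  coe α := α.toFun

/-- The topology of pointwise convergence. -/
instance : TopologicalSpace (PolySeminorm K V) :=
  TopologicalSpace.induced (fun α => (α : SymmetricAlgebra K V → ℝ≥0)) inferInstance

variable {K V}

/-- `f ∈ Sym V` is homogeneous of degree `d`: it is a sum of products of `d` vectors of `V`. -/
def IsHomogeneous (f : SymmetricAlgebra K V) (d : ℕ) : Prop :=
  f ∈ LinearMap.range (SymmetricAlgebra.ι K V) ^ d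

variable (K V)

/-- `α ∼ β` if for some `c > 0` one has `α(f) = c ^ d * β(f)` for all homogeneous `f` of
degree `d` and all `d`. -/
instance polySetoid : Setoid (PolySeminorm K V) where
  r α β := ∃ c : ℝ≥0, 0 < c ∧ ∀ (d : ℕ) (f : SymmetricAlgebra K V), IsHomogeneous f d →
    α f = c ^ d * β f
  iseqv :=
    { refl := fun α => ⟨1, one_pos, fun d f _ => by rw [one_pow, one_mul]⟩
      symm := by
        rintro α β ⟨c, hc, h⟩
        refine ⟨c⁻¹, inv_pos.2 hc, fun d f hf => ?_⟩
        rw [h d f hf, inv_pow, inv_mul_cancel_left₀ (pow_ne_zero d hc.ne')]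
      trans := by
        rintro α β δ ⟨c, hc, h⟩ ⟨e, he, h'⟩
        refine ⟨c * e, mul_pos hc he, fun d f hf => ?_⟩
        rw [h d f hf, h' d f hf, mul_pow, mul_assoc] }

/-- The Berkovich projective space `ℙ(V)^an`, where `ℙ(V) = Proj Sym V`. -/
def PAn : Type _ := Quotient (polySetoid K V)

/-- The topology of `ℙ(V)^an`: the quotient topology from the punctured affine cone. -/
instance : TopologicalSpace (PAn K V) :=
  inferInstanceAs (TopologicalSpace (Quotient (polySetoid K V)))

variable {K V}

/-- The point of `ℙ(V)^an` represented by a multiplicative seminorm on `Sym V`. -/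
def PAn.mk (α : PolySeminorm K V) : PAn K V := Quotient.mk (polySetoid K V) α

/-- The `K`-rational hyperplane of `ℙ(V)^an` cut out by the linear form `v ∈ V`. -/
def hyperplane (v : V) : Set (PAn K V) :=
  {x | ∃ α : PolySeminorm K V, α (SymmetricAlgebra.ι K V v) = 0 ∧ PAn.mk α = x}

variable (K V)

/-- Drinfeld's symmetric domain `Ω^an`: the complement in `ℙ(V)^an` of the union of all
`K`-rational hyperplanes. -/
def omegaAn : Set (PAn K V) := (⋃ (v : V) (_ : v ≠ 0), hyperplane v)ᶜ

/-! ### The group `PGL(V)` and its actions -/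

/-- The subgroup of scalars in `GL(V)`. -/
def scalars : Subgroup (V ≃ₗ[K] V) := (DistribMulAction.toModuleAut K V : Kˣ →* (V ≃ₗ[K] V)).range

variable {K V} in
lemma mem_scalars {g : V ≃ₗ[K] V} : g ∈ scalars K V ↔ ∃ a : Kˣ, ∀ v, g v = (a : K) • v := by
  constructor
  · rintro ⟨a, rfl⟩
    exact ⟨a, fun v => rfl⟩
  · rintro ⟨a, h⟩
    exact ⟨a, LinearEquiv.ext fun v => (h v).symm⟩

instance : (scalars K V).Normal where
  conj_mem g hg h := by
    obtain ⟨a, ha⟩ := mem_scalars.1 hg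
    refine mem_scalars.2 ⟨a, fun v => ?_⟩
    change h (g (h⁻¹ v)) = _
    rw [ha, map_smul]
    congr 1
    exact h.apply_symm_apply v

/-- `PGL(V) = GL(V) / Kˣ`. -/
abbrev PGL : Type _ := (V ≃ₗ[K] V) ⧸ scalars K V

variable {K V}

/-- The action of `GL(V)` on seminorms: `g(γ) = γ ∘ g⁻¹`. -/
instance : MulAction (V ≃ₗ[K] V) (VectorSeminorm K V) where
  smul g γ :=
    { toFun := fun v => γ (g⁻¹ v)
      map_smul' := fun a v => by rw [map_smul]; exact γ.map_smul' _ _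
      map_add_le_max' := fun v w => by rw [map_add]; exact γ.map_add_le_max' _ _
      exists_ne_zero' := by
        obtain ⟨v, hv⟩ := γ.exists_ne_zero'
        refine ⟨g v, ?_⟩
        have : g⁻¹ (g v) = v := g.symm_apply_apply v
        rwa [this] }
  one_smul γ := rfl
  mul_smul g h γ := DFunLike.ext _ _ fun v => by
    change γ ((g * h)⁻¹ v) = γ (h⁻¹ (g⁻¹ v))
    rw [mul_inv_rev]; rfl

lemma VectorSeminorm.smul_apply (g : V ≃ₗ[K] V) (γ : VectorSeminorm K V) (v : V) :
    (g • γ) v = γ (g⁻¹ v) := rfl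

instance glActionXBar : MulAction (V ≃ₗ[K] V) (XBar K V) where
  smul g := Quotient.map (g • ·) (by
    rintro γ δ ⟨c, hc, h⟩
    exact ⟨c, hc, fun v => h _⟩)
  one_smul x := by
    induction x using Quotient.inductionOn with
    | h γ => exact congrArg (Quotient.mk _) (one_smul _ γ)
  mul_smul g h x := by
    induction x using Quotient.inductionOn with
    | h γ => exact congrArg (Quotient.mk _) (mul_smul g h γ)

/-- The action of `PGL(V)` on `X̄`. -/
instance : MulAction (PGL K V) (XBar K V) :=
  MulAction.compHom (XBar K V) (QuotientGroup.lift (scalars K V)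
    (MulAction.toPermHom (V ≃ₗ[K] V) (XBar K V)) (by
      intro g hg
      obtain ⟨a, ha⟩ := mem_scalars.1 ((scalars K V).inv_mem hg)
      ext x
      induction x using Quotient.inductionOn with
      | h γ =>
        refine Quotient.sound ⟨‖(a : K)‖₊, by simp, fun v => ?_⟩
        change γ (g⁻¹ v) = _
        rw [ha]
        exact γ.map_smul' _ _))

lemma XBar.smul_mk (g : V ≃ₗ[K] V) (γ : VectorSeminorm K V) :
    (QuotientGroup.mk g : PGL K V) • XBar.mk γ = XBar.mk (g • γ) := rfl

/-- The endomorphism of `Sym V` induced by a linear endomorphism of `V`. -/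
def symMap (g : V →ₗ[K] V) : SymmetricAlgebra K V →ₐ[K] SymmetricAlgebra K V :=
  SymmetricAlgebra.lift (SymmetricAlgebra.ι K V ∘ₗ g)

lemma symMap_ι (g : V →ₗ[K] V) (v : V) :
    symMap g (SymmetricAlgebra.ι K V v) = SymmetricAlgebra.ι K V (g v) :=
  SymmetricAlgebra.lift_ι_apply _ _

lemma symMap_id : symMap (LinearMap.id : V →ₗ[K] V) = AlgHom.id K _ :=
  SymmetricAlgebra.algHom_ext (LinearMap.ext fun v => symMap_ι _ v)

lemma symMap_comp (g h : V →ₗ[K] V) : symMap (g ∘ₗ h) = (symMap g).comp (symMap h) :=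
  SymmetricAlgebra.algHom_ext (LinearMap.ext fun v => by
    simp [symMap_ι])

lemma IsHomogeneous.symMap {f : SymmetricAlgebra K V} {d : ℕ} (hf : IsHomogeneous f d)
    (g : V →ₗ[K] V) : IsHomogeneous (symMap g f) d := by
  have h : LinearMap.range (SymmetricAlgebra.ι K V) ^ d ≤
      (LinearMap.range (SymmetricAlgebra.ι K V) ^ d).comap
        (SeminormCompactification.symMap g).toLinearMap := by
    rw [← Submodule.map_le_iff_le_comap, Submodule.map_pow]
    refine pow_le_pow_left' ?_ d
    rintro _ ⟨_, ⟨v, rfl⟩, rfl⟩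
    exact ⟨g v, (symMap_ι g v).symm⟩
  exact h hf

lemma symMap_of_scalar {f : SymmetricAlgebra K V} {d : ℕ} (hf : IsHomogeneous f d)
    {g : V →ₗ[K] V} {a : K} (hg : ∀ v, g v = a • v) : symMap g f = a ^ d • f := by
  unfold IsHomogeneous at hf
  induction d generalizing f with
  | zero =>
    rw [pow_zero] at hf
    obtain ⟨c, rfl⟩ := Submodule.mem_one.1 hf
    simp
  | succ d ih =>
    rw [pow_succ] at hf
    refine Submodule.mul_induction_on hf ?_ ?_
    · rintro m hm _ ⟨v, rfl⟩
      rw [map_mul, ih hm, symMap_ι, hg, map_smul, smul_mul_smul_comm, pow_succ]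
    · intro x y hx hy
      rw [map_add, hx, hy, smul_add]

/-- The action of `GL(V)` on multiplicative seminorms: `g(α) = α ∘ Sym(g⁻¹)`. -/
instance : MulAction (V ≃ₗ[K] V) (PolySeminorm K V) where
  smul g α :=
    { α.toValuation.comap (symMap (g⁻¹ : V ≃ₗ[K] V).toLinearMap).toRingHom with
      map_algebraMap' := fun a => by
        change α (symMap _ (algebraMap _ _ a)) = _
        rw [AlgHom.commutes]; exact α.map_algebraMap' a
      exists_ne_zero' := by
        obtain ⟨v, hv⟩ := α.exists_ne_zero'
        refine ⟨g v, ?_⟩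
        change α (symMap _ _) ≠ 0
        rw [symMap_ι]
        have : (g⁻¹ : V ≃ₗ[K] V).toLinearMap (g v) = v := g.symm_apply_apply v
        rwa [this] }
  one_smul α := by
    have h : ∀ f, symMap ((1 : V ≃ₗ[K] V)⁻¹ : V ≃ₗ[K] V).toLinearMap f = f := fun f =>
      congrArg (fun φ : SymmetricAlgebra K V →ₐ[K] SymmetricAlgebra K V => φ f) symMap_id
    obtain ⟨α, h1, h2⟩ := α
    refine (PolySeminorm.mk.injEq ..).mpr (Valuation.ext fun f => ?_)
    change α (symMap _ f) = α f
    rw [h]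
  mul_smul g h α := by
    have e : ∀ f, symMap ((g * h)⁻¹ : V ≃ₗ[K] V).toLinearMap f =
        symMap (h⁻¹ : V ≃ₗ[K] V).toLinearMap (symMap (g⁻¹ : V ≃ₗ[K] V).toLinearMap f) := by
      intro f
      rw [← AlgHom.comp_apply, ← symMap_comp, mul_inv_rev]; rfl
    obtain ⟨α, h1, h2⟩ := α
    refine (PolySeminorm.mk.injEq ..).mpr (Valuation.ext fun f => ?_)
    change α (symMap _ f) = α (symMap _ (symMap _ f))
    rw [e]

lemma PolySeminorm.smul_apply (g : V ≃ₗ[K] V) (α : PolySeminorm K V) (f : SymmetricAlgebra K V) :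
    (g • α) f = α (symMap (g⁻¹ : V ≃ₗ[K] V).toLinearMap f) := rfl

instance glActionPAn : MulAction (V ≃ₗ[K] V) (PAn K V) where
  smul g := Quotient.map (g • ·) (by
    rintro α β ⟨c, hc, h⟩
    exact ⟨c, hc, fun d f hf => h d _ (hf.symMap _)⟩)
  one_smul x := by
    induction x using Quotient.inductionOn with
    | h α => exact congrArg (Quotient.mk _) (one_smul _ α)
  mul_smul g h x := by
    induction x using Quotient.inductionOn with
    | h α => exact congrArg (Quotient.mk _) (mul_smul g h α)

/-- The action of `PGL(V)` on `ℙ(V)^an`. -/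
instance : MulAction (PGL K V) (PAn K V) :=
  MulAction.compHom (PAn K V) (QuotientGroup.lift (scalars K V)
    (MulAction.toPermHom (V ≃ₗ[K] V) (PAn K V)) (by
      intro g hg
      obtain ⟨a, ha⟩ := mem_scalars.1 ((scalars K V).inv_mem hg)
      ext x
      induction x using Quotient.inductionOn with
      | h α =>
        refine Quotient.sound ⟨‖(a : K)‖₊, by simp, fun d f hf => ?_⟩
        change α (symMap (g⁻¹ : V ≃ₗ[K] V).toLinearMap f) = _
        rw [symMap_of_scalar hf (g := (g⁻¹ : V ≃ₗ[K] V).toLinearMap) ha, Algebra.smul_def]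
        refine (α.map_mul' _ _).trans ?_
        congr 1
        refine (α.map_algebraMap' _).trans ?_
        rw [nnnorm_pow]))

lemma PAn.smul_mk (g : V ≃ₗ[K] V) (α : PolySeminorm K V) :
    (QuotientGroup.mk g : PGL K V) • PAn.mk α = PAn.mk (g • α) := rfl

/-! ### The reduction map -/

/-- The restriction to `V` of a multiplicative seminorm on `Sym V`. -/
def PolySeminorm.restrict (α : PolySeminorm K V) : VectorSeminorm K V where
  toFun v := α (SymmetricAlgebra.ι K V v)
  map_smul' a v := by
    rw [map_smul, Algebra.smul_def]
    exact (α.map_mul' _ _).trans (congrArg (· * _) (α.map_algebraMap' a))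
  map_add_le_max' v w := by
    rw [map_add]; exact α.map_add_le_max' _ _
  exists_ne_zero' := α.exists_ne_zero'

variable (K V)

/-- The map `r : ℙ(V)^an → X̄` induced by restricting multiplicative seminorms from `Sym V`
to `V`. -/
def reductionMap : PAn K V → XBar K V :=
  Quotient.map PolySeminorm.restrict (by
    rintro α β ⟨c, hc, h⟩
    refine ⟨c, hc, fun v => ?_⟩
    have := h 1 (SymmetricAlgebra.ι K V v) (by
      rw [IsHomogeneous, pow_one]; exact ⟨v, rfl⟩)
    rwa [pow_one] at this)

variable {K V}

lemma reductionMap_mk (α : PolySeminorm K V) :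
    reductionMap K V (PAn.mk α) = XBar.mk α.restrict := rfl

/-- For `f = ∑ a_ν b^ν` in `Sym V`, written as a polynomial in the basis vectors `bᵢ`, the
number `sup_ν |a_ν| ∏ᵢ γ(bᵢ)^{νᵢ}`. -/
def gaussExtension (γ : VectorSeminorm K V) {κ : Type*} (b : Module.Basis κ K V)
    (f : SymmetricAlgebra K V) : ℝ≥0 :=
  let p : MvPolynomial κ K := SymmetricAlgebra.equivMvPolynomial b f
  p.support.sup fun ν => ‖p.coeff ν‖₊ * ν.prod fun i k => γ (b i) ^ k

/-! ### The reduction maps on Drinfeld's symmetric domain -/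

lemma isNorm_restrict_of_mem_omegaAn {α : PolySeminorm K V} (h : PAn.mk α ∈ omegaAn K V) :
    α.restrict.IsNorm := fun v hv h0 =>
  h (Set.mem_iUnion₂.2 ⟨v, hv, α, h0, rfl⟩)

/-- Berkovich's reduction map `Ω^an → X`: it maps a point represented by `α` to the class of
the norm `α|_V` (which does not depend on the representative `α`). -/
def berkovichReduction (x : omegaAn K V) : building K V :=
  ⟨XBar.mk (PolySeminorm.restrict (Quotient.out (x : PAn K V))),
    _, isNorm_restrict_of_mem_omegaAn (by
      have := x.2
      rwa [← Quotient.out_eq (x : PAn K V)] at this), rfl⟩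

lemma lift_smul_of_isHomogeneous {f : SymmetricAlgebra K V} {d : ℕ} (hf : IsHomogeneous f d)
    (z : V →ₗ[K] AlgebraicClosure K) (t : AlgebraicClosure K) :
    SymmetricAlgebra.lift (t • z) f = t ^ d * SymmetricAlgebra.lift z f := by
  unfold IsHomogeneous at hf
  induction d generalizing f with
  | zero =>
    rw [pow_zero] at hf
    obtain ⟨c, rfl⟩ := Submodule.mem_one.1 hf
    simp
  | succ d ih =>
    rw [pow_succ] at hf
    refine Submodule.mul_induction_on hf ?_ ?_
    · rintro m hm _ ⟨v, rfl⟩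
      rw [map_mul, map_mul, ih hm, SymmetricAlgebra.lift_ι_apply, SymmetricAlgebra.lift_ι_apply,
        LinearMap.smul_apply, smul_eq_mul]
      ring
    · intro x y hx hy
      rw [map_add, map_add, hx, hy, mul_add]

section AlgebraicPoints

variable [IsUltrametricDist K] [CompleteSpace K]

/-- The absolute value of the algebraic closure of `K` which extends the one of `K`. -/
def absAlg : Valuation (AlgebraicClosure K) ℝ≥0 where
  toFun x := ⟨spectralMulAlgNorm K (AlgebraicClosure K) x, apply_nonneg _ x⟩
  map_zero' := NNReal.eq (map_zero (spectralMulAlgNorm K (AlgebraicClosure K)))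
  map_one' := NNReal.eq (map_one (spectralMulAlgNorm K (AlgebraicClosure K)))
  map_mul' x y := NNReal.eq (map_mul (spectralMulAlgNorm K (AlgebraicClosure K)) x y)
  map_add_le_max' x y := isNonarchimedean_spectralNorm (K := K) x y

lemma absAlg_algebraMap (a : K) : absAlg (algebraMap K (AlgebraicClosure K) a) = ‖a‖₊ :=
  NNReal.eq (spectralNorm_extends a)

lemma exists_absAlg_ne_zero {z : V →ₗ[K] AlgebraicClosure K} (hz : z ≠ 0) :
    ∃ v, absAlg (z v) ≠ 0 := by
  by_contra! h
  exact hz (LinearMap.ext fun v => absAlg.zero_iff.1 (h v))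

/-- The seminorm `v ↦ |z(v)|` on `V` for a nonzero `K̄`-valued linear form `z` on `V`. -/
def absSeminorm (z : V →ₗ[K] AlgebraicClosure K) (hz : z ≠ 0) : VectorSeminorm K V where
  toFun v := absAlg (z v)
  map_smul' a v := by rw [map_smul, Algebra.smul_def, map_mul, absAlg_algebraMap]
  map_add_le_max' v w := by rw [map_add]; exact absAlg.map_add _ _
  exists_ne_zero' := exists_absAlg_ne_zero hz

/-- The multiplicative seminorm `f ↦ |f(z)|` on `Sym V`. -/
def evalSeminorm (z : V →ₗ[K] AlgebraicClosure K) (hz : z ≠ 0) : PolySeminorm K V :=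
  { absAlg.comap (SymmetricAlgebra.lift z).toRingHom with
    map_algebraMap' := fun a => by
      change absAlg (SymmetricAlgebra.lift z (algebraMap _ _ a)) = _
      rw [AlgHom.commutes, absAlg_algebraMap]
    exists_ne_zero' := by
      obtain ⟨v, hv⟩ := exists_absAlg_ne_zero hz
      refine ⟨v, ?_⟩
      change absAlg (SymmetricAlgebra.lift z _) ≠ 0
      rwa [SymmetricAlgebra.lift_ι_apply] }

variable (K V)

/-- The `K̄`-rational points of `ℙ(V)`: lines in the dual space of `V ⊗ K̄`, i.e. in the `K̄`-vector
space of `K`-linear maps `V → K̄`. -/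
abbrev AlgPoint : Type _ := ℙ (AlgebraicClosure K) (V →ₗ[K] AlgebraicClosure K)

/-- The `K̄`-rational points of Drinfeld's symmetric domain `Ω`: the lines which lie on no
`K`-rational hyperplane. -/
def omegaAlg : Set (AlgPoint K V) := {x | ∀ v : V, v ≠ 0 → x.rep v ≠ 0}

variable {K V}

/-- The point of `ℙ(V)^an` given by a `K̄`-rational point of `ℙ(V)`. -/
def AlgPoint.toPAn (x : AlgPoint K V) : PAn K V :=
  Projectivization.lift (fun z => PAn.mk (evalSeminorm z.1 z.2)) (by
    rintro ⟨z, hz⟩ ⟨w, hw⟩ t (rfl : z = t • w)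
    refine Quotient.sound ⟨absAlg t, ?_, fun d f hf => ?_⟩
    · refine pos_iff_ne_zero.2 ((Valuation.ne_zero_iff _).2 ?_)
      rintro rfl
      exact hz (zero_smul _ w)
    · change absAlg (SymmetricAlgebra.lift (t • w) f) = _ * absAlg (SymmetricAlgebra.lift w f)
      rw [lift_smul_of_isHomogeneous hf, map_mul, map_pow]) x

/-- Drinfeld's reduction map `Ω → X` on `K̄`-rational points: a line is sent to the class of
the norm `v ↦ |z(v)|`, for any `z ≠ 0` on the line. -/
def drinfeldReduction (x : omegaAlg K V) : building K V :=
  ⟨XBar.mk (absSeminorm x.1.rep x.1.rep_nonzero), _, fun v hv h0 =>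
    x.2 v hv (absAlg.zero_iff.1 h0), rfl⟩

end AlgebraicPoints

end SeminormCompactification

end

open scoped NNReal

noncomputable section

namespace SeminormCompactification

/-! Everything rests on an extremal description of the Gauss extension. A multiplicative seminorm on
`Sym V` is dominated by the Gauss norm of any basis whose radii bound it on the basis vectors
(`valuation_le_gaussNorm`). If γ is canonical for b, its Gauss extension is itself multiplicative
(`gaussNorm_mul`) and restricts to γ. It is therefore the largest multiplicative seminorm
restricting to γ, and also the smallest of the Gauss extensions of γ over all bases. Hence it does
not depend on b, and the maximality gives equivariance of j.

Compactness of GL(n, 𝒪), available because K is locally compact, enters twice. For fixed γ, the sum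
of the values of γ on the columns attains its minimum there, and a minimizer is a canonical basis: a
cancellation violating canonicity would give an integral column operation lowering the sum
(`exists_integralGL_sum_lt`). Moreover the canonical extension at f is the minimum over this one
compact set, the same for all γ, of a function jointly continuous in γ and the matrix pair
(`canonicalExtension_eq_sInf`). So it is continuous in γ.

The rest is formal. The map r is restriction to V, and j is a continuous section of it, hence an
embedding. Its image is closed because it is cut out by equalities between continuous functions of
α. -/

/-! ### Gauss norms on polynomial rings -/

section GaussNorm

variable {K : Type*} [NontriviallyNormedField K] {σ : Type*}

/-- The weight `∏ r i ^ ν i` of an exponent vector. -/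
def weight (r : σ → ℝ≥0) (ν : σ →₀ ℕ) : ℝ≥0 := ν.prod fun i k => r i ^ k

lemma weight_add (r : σ → ℝ≥0) (ν μ : σ →₀ ℕ) : weight r (ν + μ) = weight r ν * weight r μ := by
  classical
  exact Finsupp.prod_add_index' (fun i => pow_zero _) fun i => pow_add _

@[simp] lemma weight_zero (r : σ → ℝ≥0) : weight r 0 = 1 := Finsupp.prod_zero_index

@[simp] lemma weight_single (r : σ → ℝ≥0) (i : σ) : weight r (Finsupp.single i 1) = r i := by
  simp [weight]

lemma weight_mono {r s : σ → ℝ≥0} (h : ∀ i, r i ≤ s i) (ν : σ →₀ ℕ) : weight r ν ≤ weight s ν :=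
  Finset.prod_le_prod' fun i _ => pow_le_pow_left' (h i) _

lemma weight_smul (c : ℝ≥0) (r : σ → ℝ≥0) (ν : σ →₀ ℕ) :
    weight (fun i => c * r i) ν = c ^ ν.degree * weight r ν := by
  simp [weight, Finsupp.prod, mul_pow, Finset.prod_mul_distrib, Finset.prod_pow_eq_pow_sum,
    Finsupp.degree_apply]

/-- The Gauss norm of a polynomial with radii `r`. -/
def gaussNorm (r : σ → ℝ≥0) (p : MvPolynomial σ K) : ℝ≥0 :=
  p.support.sup fun ν => ‖p.coeff ν‖₊ * weight r ν

lemma le_gaussNorm (r : σ → ℝ≥0) (p : MvPolynomial σ K) (ν : σ →₀ ℕ) :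
    ‖p.coeff ν‖₊ * weight r ν ≤ gaussNorm r p := by
  by_cases h : ν ∈ p.support
  · exact Finset.le_sup (f := fun ν => ‖p.coeff ν‖₊ * weight r ν) h
  · rw [MvPolynomial.notMem_support_iff.1 h]
    simp

lemma gaussNorm_le {r : σ → ℝ≥0} {p : MvPolynomial σ K} {c : ℝ≥0}
    (h : ∀ ν, ‖p.coeff ν‖₊ * weight r ν ≤ c) : gaussNorm r p ≤ c :=
  Finset.sup_le fun ν _ => h ν

/-- Extra exponents contribute zero. A fixed index set is needed for continuity when the polynomial
varies and its support jumps. -/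
lemma gaussNorm_eq_sup_of_support_subset (r : σ → ℝ≥0) {p : MvPolynomial σ K}
    {S : Finset (σ →₀ ℕ)} (h : p.support ⊆ S) :
    gaussNorm r p = S.sup fun ν => ‖p.coeff ν‖₊ * weight r ν :=
  le_antisymm (Finset.sup_mono h) (Finset.sup_le fun ν _ => le_gaussNorm r p ν)

@[simp] lemma gaussNorm_C (r : σ → ℝ≥0) (a : K) :
    gaussNorm r (MvPolynomial.C a : MvPolynomial σ K) = ‖a‖₊ := by
  classical
  refine le_antisymm (gaussNorm_le fun ν => ?_) ?_
  · rw [MvPolynomial.coeff_C]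
    split_ifs with h
    · simp [← h]
    · simp
  · simpa using le_gaussNorm r (MvPolynomial.C a : MvPolynomial σ K) 0

lemma gaussNorm_smul_of_isHomogeneous {p : MvPolynomial σ K} {d : ℕ} (hp : p.IsHomogeneous d)
    (c : ℝ≥0) (r : σ → ℝ≥0) : gaussNorm (fun i => c * r i) p = c ^ d * gaussNorm r p := by
  rw [gaussNorm, gaussNorm, NNReal.mul_finset_sup]
  refine Finset.sup_congr rfl fun ν hν => ?_
  have hd : ν.degree = d := by
    by_contra h
    exact MvPolynomial.mem_support_iff.1 hν (hp.coeff_eq_zero h)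
  rw [weight_smul, hd]
  ring

lemma gaussNorm_linear [Fintype σ] (r : σ → ℝ≥0) (c : σ → K) :
    gaussNorm r (∑ i, c i • (MvPolynomial.X i : MvPolynomial σ K)) = Finset.univ.sup fun i => ‖c i‖₊ * r i := by
  classical
  have hc (ν : σ →₀ ℕ) : (∑ i, c i • (MvPolynomial.X i : MvPolynomial σ K)).coeff ν =
      ∑ i, if Finsupp.single i 1 = ν then c i else 0 := by
    simp [MvPolynomial.coeff_sum, MvPolynomial.coeff_X]
  refine le_antisymm (gaussNorm_le fun ν => ?_) (Finset.sup_le fun i _ => ?_)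
  · rw [hc]
    by_cases h : ∃ i, Finsupp.single i 1 = ν
    · obtain ⟨i, rfl⟩ := h
      simp only [Finsupp.single_left_inj one_ne_zero, Finset.sum_ite_eq', Finset.mem_univ, if_true,
        weight_single]
      exact Finset.le_sup (f := fun i => ‖c i‖₊ * r i) (Finset.mem_univ i)
    · rw [Finset.sum_eq_zero fun i _ => if_neg fun hi => h ⟨i, hi⟩]
      simp
  · have := le_gaussNorm r (∑ i, c i • (MvPolynomial.X i : MvPolynomial σ K)) (Finsupp.single i 1)
    simpa only [hc, Finsupp.single_left_inj one_ne_zero, Finset.sum_ite_eq', Finset.mem_univ,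
      if_true, weight_single] using this

/-- A nonzero Gauss norm is attained at a lexicographically smallest exponent. -/
lemma exists_lex_min_gaussNorm [LinearOrder σ] {r : σ → ℝ≥0} {p : MvPolynomial σ K}
    (h : gaussNorm r p ≠ 0) : ∃ ν, ‖p.coeff ν‖₊ * weight r ν = gaussNorm r p ∧
      ∀ μ, ‖p.coeff μ‖₊ * weight r μ = gaussNorm r p → toLex ν ≤ toLex μ := by
  classical
  set S := p.support.filter fun ν => ‖p.coeff ν‖₊ * weight r ν = gaussNorm r p with hS
  have mem_S {ν} : ν ∈ S ↔ ‖p.coeff ν‖₊ * weight r ν = gaussNorm r p := by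
    rw [hS, Finset.mem_filter, and_iff_right_iff_imp]
    intro hν
    rw [MvPolynomial.mem_support_iff]
    intro h0
    rw [h0, nnnorm_zero, zero_mul] at hν
    exact h hν.symm
  have hne : p.support.Nonempty := by
    rw [Finset.nonempty_iff_ne_empty]
    intro h0
    exact h (by rw [gaussNorm, h0]; rfl)
  obtain ⟨ν, -, hν⟩ := Finset.exists_mem_eq_sup _ hne fun ν => ‖p.coeff ν‖₊ * weight r ν
  obtain ⟨ν₀, h₀, hmin⟩ := Finset.exists_min_image S toLex ⟨ν, mem_S.2 hν.symm⟩
  exact ⟨ν₀, mem_S.1 h₀, fun μ hμ => hmin μ (mem_S.2 hμ)⟩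

/-- The Gauss norm dominates every valuation which extends the absolute value and has the
given values at the variables. -/
lemma valuation_le_gaussNorm {v : Valuation (MvPolynomial σ K) ℝ≥0}
    (hv : ∀ a, v (MvPolynomial.C a) = ‖a‖₊) {r : σ → ℝ≥0} (hr : ∀ i, v (MvPolynomial.X i) ≤ r i)
    (p : MvPolynomial σ K) : v p ≤ gaussNorm r p := by
  conv_lhs => rw [p.as_sum]
  refine v.map_sum_le fun ν _ => le_trans ?_ (le_gaussNorm r p ν)
  rw [MvPolynomial.monomial_eq, map_mul, hv]
  refine mul_le_mul_right ?_ _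
  rw [Finsupp.prod, map_prod]
  simp only [map_pow]
  exact weight_mono hr ν

/-! ### Multiplicativity of Gauss norms -/

variable [IsUltrametricDist K]

lemma gaussNorm_add_le_max (r : σ → ℝ≥0) (p q : MvPolynomial σ K) :
    gaussNorm r (p + q) ≤ max (gaussNorm r p) (gaussNorm r q) := by
  refine gaussNorm_le fun ν => ?_
  rw [MvPolynomial.coeff_add]
  refine (mul_le_mul_left (IsUltrametricDist.nnnorm_add_le_max _ _) _).trans ?_
  rw [max_mul]
  exact max_le_max (le_gaussNorm r p ν) (le_gaussNorm r q ν)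

lemma gaussNorm_mul_le (r : σ → ℝ≥0) (p q : MvPolynomial σ K) :
    gaussNorm r (p * q) ≤ gaussNorm r p * gaussNorm r q := by
  classical
  refine gaussNorm_le fun ν => ?_
  rw [MvPolynomial.coeff_mul]
  by_cases hw : weight r ν = 0
  · simp [hw]
  -- Moving the weight to the right leaves a bare norm of a sum, to which the ultrametric inequality
  -- applies.
  rw [← le_div_iff₀ (pos_iff_ne_zero.2 hw)]
  refine IsUltrametricDist.nnnorm_sum_le_of_forall_le fun x hx => ?_
  rw [le_div_iff₀ (pos_iff_ne_zero.2 hw), ← Finset.HasAntidiagonal.mem_antidiagonal.1 hx, weight_add, nnnorm_mul,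
    mul_mul_mul_comm]
  exact mul_le_mul' (le_gaussNorm r p _) (le_gaussNorm r q _)

/-- As in Gauss's lemma: multiply the lexicographically smallest terms attaining the two norms.
Every other contribution to the same exponent is strictly smaller, so nothing cancels it. The order
on the variables serves only to select these terms. -/
lemma gaussNorm_mul [LinearOrder σ] (r : σ → ℝ≥0) (p q : MvPolynomial σ K) :
    gaussNorm r (p * q) = gaussNorm r p * gaussNorm r q := by
  classical
  refine le_antisymm (gaussNorm_mul_le r p q) ?_
  by_cases hp : gaussNorm r p = 0
  · simp [hp]
  by_cases hq : gaussNorm r q = 0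
  · simp [hq]
  obtain ⟨ν, hν, hνmin⟩ := exists_lex_min_gaussNorm hp
  obtain ⟨μ, hμ, hμmin⟩ := exists_lex_min_gaussNorm hq
  -- Radii may vanish, since γ need not be a norm; exponents attaining a nonzero Gauss norm have
  -- nonzero weight.
  have hw : 0 < weight r (ν + μ) := by
    rw [weight_add, pos_iff_ne_zero]
    refine mul_ne_zero (fun h => hp ?_) fun h => hq ?_
    · rw [← hν, h, mul_zero]
    · rw [← hμ, h, mul_zero]
  have hprod : ‖p.coeff ν * q.coeff μ‖₊ * weight r (ν + μ) = gaussNorm r p * gaussNorm r q := by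
    rw [weight_add, nnnorm_mul, mul_mul_mul_comm, hν, hμ]
  have hpq : NormedField.valuation (p.coeff ν * q.coeff μ) ≠ 0 := by
    change ‖p.coeff ν * q.coeff μ‖₊ ≠ 0
    intro h
    rw [h, zero_mul] at hprod
    exact mul_ne_zero hp hq hprod.symm
  have hlt : NormedField.valuation (∑ x ∈ (Finset.HasAntidiagonal.antidiagonal (ν + μ)).erase (ν, μ),
      p.coeff x.1 * q.coeff x.2) < NormedField.valuation (p.coeff ν * q.coeff μ) := by
    refine Valuation.map_sum_lt _ hpq fun x hx => ?_
    change ‖p.coeff x.1 * q.coeff x.2‖₊ < ‖p.coeff ν * q.coeff μ‖₊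
    obtain ⟨hne, hx⟩ := Finset.mem_erase.1 hx
    rw [Finset.HasAntidiagonal.mem_antidiagonal] at hx
    rw [← mul_lt_mul_iff_left₀ hw, hprod, ← hx, weight_add, nnnorm_mul, mul_mul_mul_comm]
    -- Equality would force both factors to attain their Gauss norms; minimality of `ν` and `μ`
    -- together with the equal sums then gives `x = (ν, μ)`.
    refine lt_of_le_of_ne (mul_le_mul' (le_gaussNorm r p _) (le_gaussNorm r q _)) fun heq => hne ?_
    have h1 : ‖p.coeff x.1‖₊ * weight r x.1 = gaussNorm r p := by
      refine le_antisymm (le_gaussNorm r p _) (le_of_not_gt fun hlt => heq.not_lt ?_)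
      exact (mul_le_mul_right (le_gaussNorm r q _) _).trans_lt
        (mul_lt_mul_of_pos_right hlt (pos_iff_ne_zero.2 hq))
    have h2 : ‖q.coeff x.2‖₊ * weight r x.2 = gaussNorm r q := by
      rw [h1] at heq
      exact mul_left_cancel₀ hp heq
    have h3 := hνmin _ h1
    have h4 := hμmin _ h2
    have h5 : toLex ν + toLex μ = toLex x.1 + toLex x.2 := congrArg toLex hx.symm
    have h6 : toLex ν = toLex x.1 := by
      refine le_antisymm h3 (le_of_not_gt fun hlt => h5.not_lt ?_)
      exact add_lt_add_of_lt_of_le hlt h4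
    rw [h6] at h5
    exact Prod.ext (toLex.injective h6.symm) (toLex.injective (add_left_cancel h5).symm)
  have hcoeff : ‖(p * q).coeff (ν + μ)‖₊ = ‖p.coeff ν * q.coeff μ‖₊ := by
    rw [MvPolynomial.coeff_mul, ← Finset.add_sum_erase _ _
      (Finset.HasAntidiagonal.mem_antidiagonal.2 rfl : (ν, μ) ∈ Finset.HasAntidiagonal.antidiagonal (ν + μ))]
    exact Valuation.map_add_eq_of_lt_left _ hlt
  rw [← hprod, ← hcoeff]
  exact le_gaussNorm r _ _

/-- The Gauss norm with radii `r` as a valuation. -/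
def gaussValuation [LinearOrder σ] (r : σ → ℝ≥0) : Valuation (MvPolynomial σ K) ℝ≥0 where
  toFun := gaussNorm r
  map_zero' := by rw [← MvPolynomial.C_0, gaussNorm_C, nnnorm_zero]
  map_one' := by rw [← MvPolynomial.C_1, gaussNorm_C, nnnorm_one]
  map_mul' := gaussNorm_mul r
  map_add_le_max' := gaussNorm_add_le_max r

end GaussNorm

/-! ### Extending seminorms from `V` to `Sym V` -/

section Extension

variable {K : Type*} [NontriviallyNormedField K] {V : Type*} [AddCommGroup V] [Module K V]

namespace VectorSeminorm

lemma map_smul_eq (γ : VectorSeminorm K V) (a : K) (v : V) : γ (a • v) = ‖a‖₊ * γ v :=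
  γ.map_smul' a v

lemma map_add_le_max (γ : VectorSeminorm K V) (v w : V) : γ (v + w) ≤ max (γ v) (γ w) :=
  γ.map_add_le_max' v w

@[simp] lemma map_zero (γ : VectorSeminorm K V) : γ 0 = 0 := by
  rw [← zero_smul K (0 : V), map_smul_eq, nnnorm_zero, zero_mul]

lemma map_sum_le (γ : VectorSeminorm K V) {ι : Type*} (s : Finset ι) (f : ι → V) :
    γ (∑ i ∈ s, f i) ≤ s.sup fun i => γ (f i) := by
  classical
  induction s using Finset.induction_on with
  | empty => simp
  | insert i s hi ih =>
    rw [Finset.sum_insert hi, Finset.sup_insert]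
    exact (γ.map_add_le_max _ _).trans (max_le_max le_rfl ih)

lemma map_sum_smul_le (γ : VectorSeminorm K V) {ι : Type*} [Fintype ι] (c : ι → K) (f : ι → V) :
    γ (∑ i, c i • f i) ≤ Finset.univ.sup fun i => ‖c i‖₊ * γ (f i) := by
  simpa only [map_smul_eq] using γ.map_sum_le Finset.univ fun i => c i • f i

end VectorSeminorm

lemma PolySeminorm.ext {α β : PolySeminorm K V} (h : ∀ f, α f = β f) : α = β := by
  obtain ⟨α, h1, h2⟩ := α
  obtain ⟨β, h3, h4⟩ := β
  exact (PolySeminorm.mk.injEq ..).mpr (Valuation.ext h)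

lemma PolySeminorm.restrict_apply (α : PolySeminorm K V) (v : V) :
    α.restrict v = α (SymmetricAlgebra.ι K V v) := rfl

lemma isHomogeneous_ι (v : V) : IsHomogeneous (SymmetricAlgebra.ι K V v) 1 := by
  rw [IsHomogeneous, pow_one]
  exact ⟨v, rfl⟩

section Basis

variable {κ : Type*}

lemma gaussExtension_eq (γ : VectorSeminorm K V) (b : Module.Basis κ K V)
    (f : SymmetricAlgebra K V) : gaussExtension γ b f =
      gaussNorm (fun i => γ (b i)) (SymmetricAlgebra.equivMvPolynomial b f) := rfl

/-- A multiplicative seminorm is dominated by every Gauss norm which dominates it on `V`. -/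
lemma PolySeminorm.le_gaussExtension {α : PolySeminorm K V} {γ : VectorSeminorm K V}
    (h : ∀ v, α.restrict v ≤ γ v) (b : Module.Basis κ K V) (f : SymmetricAlgebra K V) :
    α f ≤ gaussExtension γ b f := by
  have := valuation_le_gaussNorm (r := fun i => γ (b i))
    (v := α.toValuation.comap (SymmetricAlgebra.equivMvPolynomial b).symm.toRingHom)
    (fun a => ?_) (fun i => ?_) (SymmetricAlgebra.equivMvPolynomial b f)
  · refine le_trans (le_of_eq ?_) this
    change α f = α ((SymmetricAlgebra.equivMvPolynomial b).symm
      (SymmetricAlgebra.equivMvPolynomial b f))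
    rw [AlgEquiv.symm_apply_apply]
  · refine Eq.trans ?_ (α.map_algebraMap' a)
    change α ((SymmetricAlgebra.equivMvPolynomial b).symm (algebraMap K _ a)) = _
    rw [AlgEquiv.commutes]
  · refine le_trans (le_of_eq ?_) (h (b i))
    change α ((SymmetricAlgebra.equivMvPolynomial b).symm (MvPolynomial.X i)) = _
    rw [SymmetricAlgebra.equivMvPolynomial_symm_X]
    rfl

variable [Fintype κ]

lemma equivMvPolynomial_ι (b : Module.Basis κ K V) (v : V) :
    SymmetricAlgebra.equivMvPolynomial b (SymmetricAlgebra.ι K V v) =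
      ∑ i, b.repr v i • MvPolynomial.X i := by
  conv_lhs => rw [← b.sum_repr v]
  simp only [map_sum, map_smul, SymmetricAlgebra.equivMvPolynomial_ι_apply]

lemma IsHomogeneous.equivMvPolynomial {f : SymmetricAlgebra K V} {d : ℕ} (hf : IsHomogeneous f d)
    (b : Module.Basis κ K V) : (SymmetricAlgebra.equivMvPolynomial b f).IsHomogeneous d := by
  unfold SeminormCompactification.IsHomogeneous at hf
  induction d generalizing f with
  | zero =>
    rw [pow_zero] at hf
    obtain ⟨c, rfl⟩ := Submodule.mem_one.1 hf
    rw [AlgEquiv.commutes]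
    exact MvPolynomial.isHomogeneous_C _ c
  | succ d ih =>
    rw [pow_succ] at hf
    refine Submodule.mul_induction_on hf ?_ ?_
    · rintro m hm _ ⟨v, rfl⟩
      rw [map_mul, equivMvPolynomial_ι]
      refine (ih hm).mul (MvPolynomial.IsHomogeneous.sum _ _ _ fun i _ => ?_)
      rw [MvPolynomial.smul_eq_C_mul]
      exact (MvPolynomial.isHomogeneous_X _ i).C_mul _
    · intro x y hx hy
      rw [map_add]
      exact hx.add hy

lemma gaussExtension_ι (γ : VectorSeminorm K V) (b : Module.Basis κ K V) (v : V) :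
    gaussExtension γ b (SymmetricAlgebra.ι K V v) =
      Finset.univ.sup fun i => ‖b.repr v i‖₊ * γ (b i) := by
  rw [gaussExtension_eq, equivMvPolynomial_ι, gaussNorm_linear]

/-- Valid without canonicity; it ensures that a Gauss extension does not vanish identically on `V`.
-/
lemma le_gaussExtension_ι (γ : VectorSeminorm K V) (b : Module.Basis κ K V) (v : V) :
    γ v ≤ gaussExtension γ b (SymmetricAlgebra.ι K V v) := by
  rw [gaussExtension_ι]
  conv_lhs => rw [← b.sum_repr v]
  exact γ.map_sum_smul_le _ _

lemma VectorSeminorm.IsCanonical.gaussExtension_ι {γ : VectorSeminorm K V}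
    {b : Module.Basis κ K V} (h : γ.IsCanonical b) (v : V) :
    gaussExtension γ b (SymmetricAlgebra.ι K V v) = γ v := by
  rw [SeminormCompactification.gaussExtension_ι, ← h, b.sum_repr]

variable [LinearOrder κ] [IsUltrametricDist K]

/-- The Gauss extension of a seminorm with respect to a basis, as a multiplicative seminorm. -/
def gaussSeminorm (γ : VectorSeminorm K V) (b : Module.Basis κ K V) : PolySeminorm K V :=
  { (gaussValuation fun i => γ (b i)).comap
      (SymmetricAlgebra.equivMvPolynomial b).toRingEquiv.toRingHom with
    map_algebraMap' := fun a => by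
      change gaussNorm _ (SymmetricAlgebra.equivMvPolynomial b (algebraMap _ _ a)) = _
      rw [AlgEquiv.commutes]
      exact gaussNorm_C _ a
    exists_ne_zero' := by
      obtain ⟨v, hv⟩ := γ.exists_ne_zero'
      exact ⟨v, ((pos_iff_ne_zero.2 hv).trans_le (le_gaussExtension_ι γ b v)).ne'⟩ }

lemma VectorSeminorm.IsCanonical.restrict_gaussSeminorm {γ : VectorSeminorm K V}
    {b : Module.Basis κ K V} (h : γ.IsCanonical b) : (gaussSeminorm γ b).restrict = γ :=
  DFunLike.ext _ _ fun v => h.gaussExtension_ι v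

/-- The Gauss extension for a canonical basis is the smallest among all bases. -/
lemma VectorSeminorm.IsCanonical.gaussExtension_le {γ : VectorSeminorm K V}
    {b : Module.Basis κ K V} (h : γ.IsCanonical b) {κ' : Type*} [Fintype κ']
    (b' : Module.Basis κ' K V) (f : SymmetricAlgebra K V) :
    gaussExtension γ b f ≤ gaussExtension γ b' f :=
  (gaussSeminorm γ b).le_gaussExtension (fun v => (h.gaussExtension_ι v).le) b' f

end Basis

end Extension

/-! ### Integral changes of basis -/

section IntegralBases

variable {K : Type*} [NontriviallyNormedField K] {ι : Type*} [Fintype ι]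
variable {V : Type*} [AddCommGroup V] [Module K V]

/-- The `j`-th column of a matrix as a vector of `V`. -/
def columnVector (e : Module.Basis ι K V) (M : Matrix ι ι K) (j : ι) : V := ∑ i, M i j • e i

lemma columnVector_mul (e : Module.Basis ι K V) (M N : Matrix ι ι K) (j : ι) :
    columnVector e (M * N) j = ∑ k, N k j • columnVector e M k := by
  simp only [columnVector, Matrix.mul_apply, Finset.sum_smul, Finset.smul_sum, smul_smul]
  rw [Finset.sum_comm]
  simp only [mul_comm]

/-- Evaluation of seminorms at vectors is jointly continuous. -/
lemma continuous_seminorm_apply (e : Module.Basis ι K V) :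
    Continuous fun x : VectorSeminorm K V × (ι → K) => x.1 (∑ i, x.2 i • e i) := by
  have hev (v : V) : Continuous fun γ : VectorSeminorm K V => γ v :=
    (continuous_apply v).comp continuous_induced_dom
  rw [continuous_iff_continuousAt]
  rintro ⟨γ₀, c₀⟩
  have hle (γ : VectorSeminorm K V) (v w : V) : (γ v : ℝ) ≤ γ w + γ (v - w) := by
    have h := γ.map_add_le_max w (v - w)
    rw [add_sub_cancel] at h
    exact_mod_cast h.trans (max_le_add_of_nonneg zero_le zero_le)
  have hdist (γ : VectorSeminorm K V) (v w : V) : dist (γ v) (γ w) ≤ γ (v - w) := by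
    rw [NNReal.dist_eq, abs_sub_le_iff]
    have h1 := hle γ v w
    have h2 := hle γ w v
    have h3 : γ (w - v) = γ (v - w) := by
      rw [← neg_sub, ← neg_one_smul K, γ.map_smul_eq, nnnorm_neg, nnnorm_one, one_mul]
    rw [h3] at h2
    exact ⟨by linarith, by linarith⟩
  have hmain : Filter.Tendsto (fun x : VectorSeminorm K V × (ι → K) => x.1 (∑ i, c₀ i • e i))
      (nhds (γ₀, c₀)) (nhds (γ₀ (∑ i, c₀ i • e i))) :=
    ((hev _).comp continuous_fst).tendsto (γ₀, c₀)
  refine (tendsto_iff_of_dist ?_).1 hmain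
  -- Having frozen the coefficients at `c₀`, the error is at most this sum, which tends to zero
  -- because the values on the `e i` converge.
  have hbound : Filter.Tendsto
      (fun x : VectorSeminorm K V × (ι → K) => ∑ i, ‖c₀ i - x.2 i‖ * (x.1 (e i) : ℝ))
      (nhds (γ₀, c₀)) (nhds 0) := by
    have hc : Continuous
        (fun x : VectorSeminorm K V × (ι → K) => ∑ i, ‖c₀ i - x.2 i‖ * (x.1 (e i) : ℝ)) := by
      refine continuous_finsetSum _ fun i _ => Continuous.mul ?_ ?_
      · fun_prop
      · exact NNReal.continuous_coe.comp ((hev _).comp continuous_fst)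
    simpa using hc.tendsto (γ₀, c₀)
  refine squeeze_zero (fun _ => dist_nonneg) (fun x => (hdist x.1 _ _).trans ?_) hbound
  rw [← Finset.sum_sub_distrib]
  simp only [← sub_smul]
  have h : x.1 (∑ i, (c₀ i - x.2 i) • e i) ≤ ∑ i, ‖c₀ i - x.2 i‖₊ * x.1 (e i) :=
    (x.1.map_sum_smul_le _ _).trans (Finset.sup_le fun i hi =>
      Finset.single_le_sum (f := fun i => ‖c₀ i - x.2 i‖₊ * x.1 (e i)) (fun _ _ => zero_le) hi)
  simpa using NNReal.coe_le_coe.2 h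

lemma continuous_columnVector (e : Module.Basis ι K V) (j : ι) :
    Continuous fun x : VectorSeminorm K V × Matrix ι ι K => x.1 (columnVector e x.2 j) :=
  (continuous_seminorm_apply e).comp (continuous_fst.prodMk
    (continuous_pi fun i => continuous_snd.matrix_elem i j))

/-! ### The compact group of integral matrices -/

variable [DecidableEq ι]

variable (K ι) in
/-- The group `GL(ι, 𝒪)`, as the set of all pairs of mutually inverse matrices with entries of
absolute value at most one. -/
def integralGL : Set (Matrix ι ι K × Matrix ι ι K) :=
  {p | p.1 * p.2 = 1 ∧ (∀ i j, ‖p.1 i j‖ ≤ 1) ∧ ∀ i j, ‖p.2 i j‖ ≤ 1}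

lemma one_mem_integralGL : (1, 1) ∈ integralGL K ι := by
  have h : ∀ i j, ‖(1 : Matrix ι ι K) i j‖ ≤ 1 := fun i j => by
    rw [Matrix.one_apply]
    split_ifs <;> simp
  exact ⟨mul_one 1, h, h⟩

/-- Carrying the inverse along turns integral invertibility into a closed condition on a product of
closed unit balls, which are compact since `K` is proper. -/
lemma isCompact_integralGL [ProperSpace K] : IsCompact (integralGL K ι) := by
  set B : Set (Matrix ι ι K) := Set.univ.pi fun _ => Set.univ.pi fun _ => Metric.closedBall 0 1
   
  have hBc : IsCompact B :=
    isCompact_univ_pi fun _ => isCompact_univ_pi fun _ => isCompact_closedBall _ _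
  have h : integralGL K ι = B ×ˢ B ∩ {p | p.1 * p.2 = 1} := by
    have hmem (A : Matrix ι ι K) : A ∈ B ↔ ∀ i j, ‖A i j‖ ≤ 1 :=
      Set.mem_univ_pi.trans (forall_congr' fun i => Set.mem_univ_pi.trans
        (forall_congr' fun j => mem_closedBall_zero_iff))
    ext p
    change _ ∧ _ ↔ (p.1 ∈ B ∧ p.2 ∈ B) ∧ _
    rw [hmem, hmem, and_comm]
    rfl
  rw [h]
  exact (hBc.prod hBc).inter_right (isClosed_eq (continuous_fst.matrix_mul continuous_snd)
    continuous_const)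

lemma mul_mem_integralGL [IsUltrametricDist K] {p q : Matrix ι ι K × Matrix ι ι K}
    (hp : p ∈ integralGL K ι) (hq : q ∈ integralGL K ι) :
    (p.1 * q.1, q.2 * p.2) ∈ integralGL K ι := by
  have h {A B : Matrix ι ι K} (hA : ∀ i j, ‖A i j‖ ≤ 1) (hB : ∀ i j, ‖B i j‖ ≤ 1) (i j : ι) :
      ‖(A * B) i j‖ ≤ 1 := by
    rw [Matrix.mul_apply]
    refine IsUltrametricDist.norm_sum_le_of_forall_le_of_nonneg zero_le_one fun k _ => ?_
    rw [norm_mul]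
    exact mul_le_one₀ (hA i k) (norm_nonneg _) (hB k j)
  refine ⟨?_, h hp.2.1 hq.2.1, h hq.2.2 hp.2.2⟩
  change p.1 * q.1 * (q.2 * p.2) = 1
  rw [Matrix.mul_assoc, ← Matrix.mul_assoc q.1, hq.1, Matrix.one_mul, hp.1]

/-- The matrix with `j`-th column `w` and all other columns zero. -/
def columnMatrix (j : ι) (w : ι → K) : Matrix ι ι K := Matrix.of fun i k => if k = j then w i else 0

/-- The column matrix squares to zero because `w j = 0`, so its sum with the identity is unipotent
with an explicit integral inverse. -/
lemma one_add_columnMatrix_mem_integralGL [IsUltrametricDist K] {j : ι} {w : ι → K} (hj : w j = 0)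
    (hw : ∀ i, ‖w i‖ ≤ 1) :
    (1 + columnMatrix j w, 1 - columnMatrix j w) ∈ integralGL K ι := by
  have hsq : columnMatrix j w * columnMatrix j w = 0 := by
    ext i k
    simp [Matrix.mul_apply, columnMatrix, hj]
  have h1 : ∀ i k, ‖(1 : Matrix ι ι K) i k‖ ≤ 1 := one_mem_integralGL.2.1
  have h2 : ∀ i k, ‖columnMatrix j w i k‖ ≤ 1 := fun i k => by
    simp only [columnMatrix, Matrix.of_apply]
    split_ifs
    · exact hw i
    · simp
  refine ⟨?_, fun i k => ?_, fun i k => ?_⟩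
  · simp only [mul_sub, add_mul, mul_one, one_mul, hsq]
    abel
  · exact (IsUltrametricDist.norm_add_le_max _ _).trans (max_le (h1 i k) (h2 i k))
  · rw [sub_eq_add_neg]
    refine (IsUltrametricDist.norm_add_le_max _ _).trans (max_le (h1 i k) ?_)
    rw [Matrix.neg_apply, norm_neg]
    exact h2 i k

@[simp] lemma columnVector_one (e : Module.Basis ι K V) (j : ι) : columnVector e 1 j = e j := by
  simp [columnVector, Matrix.one_apply, ite_smul]

/-- The basis of column vectors of an invertible matrix. -/
def columnBasis (e : Module.Basis ι K V) {p : Matrix ι ι K × Matrix ι ι K}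
    (hp : p ∈ integralGL K ι) : Module.Basis ι K V :=
  e.map (Matrix.toLinOfInv e e hp.1 (mul_eq_one_comm.1 hp.1))

@[simp] lemma columnBasis_apply (e : Module.Basis ι K V) {p : Matrix ι ι K × Matrix ι ι K}
    (hp : p ∈ integralGL K ι) (j : ι) : columnBasis e hp j = columnVector e p.1 j := by
  rw [columnBasis, Module.Basis.map_apply]
  exact Matrix.toLin_self e e p.1 j

lemma sum_smul_columnVector (e : Module.Basis ι K V) {p : Matrix ι ι K × Matrix ι ι K}
    (hp : p ∈ integralGL K ι) (j : ι) : ∑ k, p.2 k j • columnVector e p.1 k = e j := by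
  rw [← columnVector_mul, hp.1, columnVector_one]

lemma columnVector_mul_one_add_columnMatrix (e : Module.Basis ι K V) (M : Matrix ι ι K) (j : ι)
    (w : ι → K) (k : ι) : columnVector e (M * (1 + columnMatrix j w)) k =
      columnVector e M k + if k = j then ∑ i, w i • columnVector e M i else 0 := by
  rw [columnVector_mul]
  simp only [Matrix.add_apply, add_smul, Finset.sum_add_distrib]
  congr 1
  · simp [Matrix.one_apply, ite_smul]
  · split_ifs with h <;> simp [columnMatrix, h]

/-! ### Existence of canonical bases -/

variable [IsUltrametricDist K]

/-- If the seminorm is not canonical for the basis of column vectors, then some column can be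
modified integrally so that its seminorm decreases. -/
lemma exists_integralGL_sum_lt (γ : VectorSeminorm K V) (e : Module.Basis ι K V)
    {p : Matrix ι ι K × Matrix ι ι K} (hp : p ∈ integralGL K ι)
    (h : ¬ γ.IsCanonical (columnBasis e hp)) : ∃ q ∈ integralGL K ι,
      ∑ j, γ (columnVector e q.1 j) < ∑ j, γ (columnVector e p.1 j) := by
  simp only [VectorSeminorm.IsCanonical, columnBasis_apply, not_forall] at h
  obtain ⟨c, hc⟩ := h
  set b := columnVector e p.1 with hb
  set m := Finset.univ.sup fun i => ‖c i‖₊ * γ (b i) with hm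
  have hlt : γ (∑ i, c i • b i) < m := lt_of_le_of_ne (γ.map_sum_smul_le c b) hc
  have hmpos : 0 < m := zero_le.trans_lt hlt
  set J := Finset.univ.filter fun i => ‖c i‖₊ * γ (b i) = m with hJ
  have hne : J.Nonempty := by
    have hu : (Finset.univ : Finset ι).Nonempty := by
      rw [Finset.nonempty_iff_ne_empty]
      intro h0
      rw [hm, h0] at hmpos
      exact lt_irrefl _ hmpos
    obtain ⟨i, -, hi⟩ := Finset.exists_mem_eq_sup _ hu fun i => ‖c i‖₊ * γ (b i)
    exact ⟨i, Finset.mem_filter.2 ⟨Finset.mem_univ i, hi.symm⟩⟩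
  -- The discarded terms all have value below `m`, so the cancellation already happens among the
  -- maximal terms.
  have hJlt : γ (∑ i ∈ J, c i • b i) < m := by
    have hsplit : ∑ i ∈ J, c i • b i = ∑ i, c i • b i + ∑ i ∈ Jᶜ, (-c i) • b i := by
      rw [← Finset.sum_add_sum_compl J]
      simp
    rw [hsplit]
    refine (γ.map_add_le_max _ _).trans_lt (max_lt hlt ?_)
    refine (γ.map_sum_le _ _).trans_lt ((Finset.sup_lt_iff hmpos).2 fun i hi => ?_)
    rw [γ.map_smul_eq, nnnorm_neg]
    refine lt_of_le_of_ne (Finset.le_sup (f := fun i => ‖c i‖₊ * γ (b i)) (Finset.mem_univ i)) ?_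
    intro heq
    exact Finset.mem_compl.1 hi (Finset.mem_filter.2 ⟨Finset.mem_univ i, heq⟩)
  -- Choosing the largest coefficient in `J` makes the quotients `c i / c j` integral, so dividing
  -- the cancelling sum by `c j` gives an admissible change of column `j`.
  obtain ⟨j, hjJ, hjmax⟩ := Finset.exists_max_image J (fun i => ‖c i‖₊) hne
  have hj : ‖c j‖₊ * γ (b j) = m := (Finset.mem_filter.1 hjJ).2
  have hcj : c j ≠ 0 := by
    intro h0
    rw [h0, nnnorm_zero, zero_mul] at hj
    exact hmpos.ne hj
  set w : ι → K := fun i => if i ∈ J.erase j then (c j)⁻¹ * c i else 0 with hw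
  have hwj : w j = 0 := by simp [hw]
  have hw1 : ∀ i, ‖w i‖ ≤ 1 := by
    intro i
    simp only [hw]
    split_ifs with hi
    · rw [norm_mul, norm_inv]
      exact inv_mul_le_one_of_le₀ (hjmax i (Finset.mem_of_mem_erase hi)) (norm_nonneg _)
    · simp
  have hcol : b j + ∑ i, w i • b i = (c j)⁻¹ • ∑ i ∈ J, c i • b i := by
    rw [← Finset.add_sum_erase J _ hjJ, smul_add, inv_smul_smul₀ hcj, Finset.smul_sum]
    congr 1
    simp [hw, ite_smul, smul_smul, Finset.sum_ite_mem, -Finset.mem_erase]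
  refine ⟨_, mul_mem_integralGL hp (one_add_columnMatrix_mem_integralGL hwj hw1),
    Finset.sum_lt_sum (fun k _ => ?_) ⟨j, Finset.mem_univ j, ?_⟩⟩
  all_goals simp only [columnVector_mul_one_add_columnMatrix]
  rotate_left
  all_goals
    have hdec : γ (b j + ∑ i, w i • b i) < γ (b j) := by
      rw [hcol, γ.map_smul_eq, nnnorm_inv, inv_mul_lt_iff₀ (by simpa using hcj), hj]
      exact hJlt
  · simpa using hdec
  · split_ifs with hk
    · subst hk
      exact hdec.le
    · rw [add_zero]

/-- Every seminorm is canonical with respect to an integral change of a given basis. -/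
lemma exists_isCanonical_columnBasis [ProperSpace K] (γ : VectorSeminorm K V)
    (e : Module.Basis ι K V) : ∃ (p : Matrix ι ι K × Matrix ι ι K) (hp : p ∈ integralGL K ι),
      γ.IsCanonical (columnBasis e hp) := by
  have hcont : Continuous fun p : Matrix ι ι K × Matrix ι ι K =>
      ∑ j, γ (columnVector e p.1 j) :=
    continuous_finsetSum _ fun j _ => (continuous_columnVector e j).comp
      (continuous_const.prodMk continuous_fst)
  obtain ⟨p, hp, hmin⟩ := (isCompact_integralGL (K := K) (ι := ι)).exists_isMinOn
    ⟨_, one_mem_integralGL⟩ hcont.continuousOn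
  refine ⟨p, hp, ?_⟩
  by_contra h
  obtain ⟨q, hq, hlt⟩ := exists_integralGL_sum_lt γ e hp h
  exact (hmin hq).not_gt hlt

end IntegralBases

/-! ### The reduction map -/

section Reduction

variable {K : Type*} [NontriviallyNormedField K] {V : Type*} [AddCommGroup V] [Module K V]

lemma restrict_smul (g : V ≃ₗ[K] V) (α : PolySeminorm K V) :
    (g • α).restrict = g • α.restrict := by
  refine DFunLike.ext _ _ fun v => ?_
  change α (symMap _ (SymmetricAlgebra.ι K V v)) = α (SymmetricAlgebra.ι K V (g⁻¹ v))
  rw [symMap_ι]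
  rfl

lemma continuous_polySeminorm_apply (f : SymmetricAlgebra K V) :
    Continuous fun α : PolySeminorm K V => α f :=
  (continuous_apply f).comp continuous_induced_dom

lemma continuous_restrict : Continuous (PolySeminorm.restrict : PolySeminorm K V → _) :=
  continuous_induced_rng.2 (continuous_pi fun v =>
    continuous_polySeminorm_apply (SymmetricAlgebra.ι K V v))

lemma continuous_reductionMap : Continuous (reductionMap K V) :=
  continuous_restrict.quotient_map' _

lemma reductionMap_smul (g : PGL K V) (x : PAn K V) :
    reductionMap K V (g • x) = g • reductionMap K V x := by
  induction g using QuotientGroup.induction_on with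
  | H g =>
    induction x using Quotient.inductionOn with
    | h α => exact congrArg XBar.mk (restrict_smul g α)

lemma reductionMap_eq_berkovichReduction (x : omegaAn K V) :
    reductionMap K V (x : PAn K V) = (berkovichReduction x : XBar K V) := by
  conv_lhs => rw [← Quotient.out_eq (x : PAn K V)]
  rfl

variable [IsUltrametricDist K] [CompleteSpace K]

lemma toPAn_eq_mk (x : AlgPoint K V) :
    x.toPAn = PAn.mk (evalSeminorm x.rep x.rep_nonzero) := by
  conv_lhs => rw [← x.mk_rep]
  rfl

/-- Lying on a hyperplane is tested on some representative; equivalence in degree one transfers the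
vanishing to `evalSeminorm`, and `absAlg` vanishes only at zero. -/
lemma toPAn_mem_omegaAn (x : omegaAlg K V) : (x : AlgPoint K V).toPAn ∈ omegaAn K V := by
  rw [toPAn_eq_mk]
  intro h
  obtain ⟨v, hv, α, h0, hα⟩ := Set.mem_iUnion₂.1 h
  obtain ⟨c, hc, hcα⟩ := Quotient.exact hα
  have h1 := hcα 1 _ (isHomogeneous_ι v)
  rw [h0, pow_one, eq_comm, mul_eq_zero, or_iff_right hc.ne'] at h1
  change absAlg (SymmetricAlgebra.lift x.1.rep (SymmetricAlgebra.ι K V v)) = 0 at h1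
  rw [SymmetricAlgebra.lift_ι_apply, Valuation.zero_iff] at h1
  exact x.2 v hv h1

lemma reductionMap_eq_drinfeldReduction (x : omegaAlg K V) :
    reductionMap K V (x : AlgPoint K V).toPAn = (drinfeldReduction x : XBar K V) := by
  rw [toPAn_eq_mk, reductionMap_mk]
  refine congrArg XBar.mk (DFunLike.ext _ _ fun v => ?_)
  change absAlg (SymmetricAlgebra.lift x.1.rep (SymmetricAlgebra.ι K V v)) = absAlg (x.1.rep v)
  rw [SymmetricAlgebra.lift_ι_apply]

end Reduction

/-! ### The canonical extension and its continuity -/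

section Substitution

variable {K : Type*} [NontriviallyNormedField K] {ι : Type*} [Fintype ι]

/-- The linear substitution of variables given by a matrix. -/
def linearSubst (N : Matrix ι ι K) : MvPolynomial ι K →ₐ[K] MvPolynomial ι K :=
  MvPolynomial.aeval fun i => ∑ k, N k i • MvPolynomial.X k

/-- The recursion behind the next two inductions; the support condition guards against truncated
subtraction of exponents. -/
lemma coeff_linearSubst_mul_X [DecidableEq ι] (N : Matrix ι ι K) (p : MvPolynomial ι K) (i : ι)
    (ν : ι →₀ ℕ) : (linearSubst N (p * MvPolynomial.X i)).coeff ν =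
      ∑ k, N k i * if k ∈ ν.support then
        (linearSubst N p).coeff (ν - Finsupp.single k 1) else 0 := by
  rw [map_mul, linearSubst, MvPolynomial.aeval_X, Finset.mul_sum, MvPolynomial.coeff_sum]
  refine Finset.sum_congr rfl fun k _ => ?_
  rw [mul_smul_comm, MvPolynomial.coeff_smul, MvPolynomial.coeff_mul_X', smul_eq_mul]

lemma continuous_coeff_linearSubst (p : MvPolynomial ι K) (ν : ι →₀ ℕ) :
    Continuous fun N : Matrix ι ι K => (linearSubst N p).coeff ν := by
  classical
  induction p using MvPolynomial.induction_on generalizing ν with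
  | C a => simpa [linearSubst] using continuous_const
  | add p q hp hq =>
    simp only [map_add, MvPolynomial.coeff_add]
    exact (hp ν).add (hq ν)
  | mul_X p i hp =>
    simp only [coeff_linearSubst_mul_X]
    refine continuous_finsetSum _ fun k _ => (continuous_id.matrix_elem k i).mul ?_
    split_ifs
    · exact hp _
    · exact continuous_const

/-- Uniformity in `N` is the point: the Gauss norm becomes a supremum over a finite set independent
of the matrix. -/
lemma exists_support_linearSubst_subset (p : MvPolynomial ι K) :
    ∃ S : Finset (ι →₀ ℕ), ∀ N : Matrix ι ι K, (linearSubst N p).support ⊆ S := by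
  classical
  induction p using MvPolynomial.induction_on with
  | C a => exact ⟨(MvPolynomial.C a).support, fun N => by simp [linearSubst]⟩
  | add p q hp hq =>
    obtain ⟨S, hS⟩ := hp
    obtain ⟨T, hT⟩ := hq
    refine ⟨S ∪ T, fun N => ?_⟩
    rw [map_add]
    exact MvPolynomial.support_add.trans (Finset.union_subset_union (hS N) (hT N))
  | mul_X p i hp =>
    obtain ⟨S, hS⟩ := hp
    refine ⟨Finset.univ.biUnion fun k => S.image (· + Finsupp.single k 1), fun N ν hν => ?_⟩
    rw [MvPolynomial.mem_support_iff, coeff_linearSubst_mul_X] at hν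
    obtain ⟨k, -, hk⟩ := Finset.exists_ne_zero_of_sum_ne_zero hν
    have hk' := right_ne_zero_of_mul hk
    rw [ite_ne_right_iff] at hk'
    refine Finset.mem_biUnion.2 ⟨k, Finset.mem_univ k, Finset.mem_image.2
      ⟨_, hS N (MvPolynomial.mem_support_iff.2 hk'.2), ?_⟩⟩
    refine tsub_add_cancel_of_le (Finsupp.single_le_iff.2 ?_)
    exact Nat.one_le_iff_ne_zero.2 (Finsupp.mem_support_iff.1 hk'.1)

variable {V : Type*} [AddCommGroup V] [Module K V]

lemma continuous_gaussNorm_linearSubst (e : Module.Basis ι K V) (P : MvPolynomial ι K) :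
    Continuous fun x : VectorSeminorm K V × (Matrix ι ι K × Matrix ι ι K) =>
      gaussNorm (fun j => x.1 (columnVector e x.2.1 j)) (linearSubst x.2.2 P) := by
  obtain ⟨S, hS⟩ := exists_support_linearSubst_subset P
  simp only [gaussNorm_eq_sup_of_support_subset _ (hS _)]
  refine Continuous.finset_sup_apply fun ν _ => Continuous.mul ?_ ?_
  · exact ((continuous_coeff_linearSubst P ν).comp (continuous_snd.comp continuous_snd)).nnnorm
  · refine continuous_finsetProd _ fun j _ => Continuous.pow ?_ _
    exact (continuous_columnVector e j).comp
      (continuous_fst.prodMk (continuous_fst.comp continuous_snd))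

variable [DecidableEq ι]

/-- The columns of `p.1` are the new basis, so old basis vectors are expanded by the inverse `p.2`.
Comparing on the `e i` suffices, as `V` generates the symmetric algebra. -/
lemma equivMvPolynomial_columnBasis (e : Module.Basis ι K V) {p : Matrix ι ι K × Matrix ι ι K}
    (hp : p ∈ integralGL K ι) (f : SymmetricAlgebra K V) :
    SymmetricAlgebra.equivMvPolynomial (columnBasis e hp) f =
      linearSubst p.2 (SymmetricAlgebra.equivMvPolynomial e f) := by
  have h : (SymmetricAlgebra.equivMvPolynomial (columnBasis e hp)).toAlgHom =
      (linearSubst p.2).comp (SymmetricAlgebra.equivMvPolynomial e).toAlgHom := by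
    refine SymmetricAlgebra.algHom_ext (e.ext fun i => ?_)
    change SymmetricAlgebra.equivMvPolynomial (columnBasis e hp) (SymmetricAlgebra.ι K V (e i)) =
      linearSubst p.2 (SymmetricAlgebra.equivMvPolynomial e (SymmetricAlgebra.ι K V (e i)))
    rw [SymmetricAlgebra.equivMvPolynomial_ι_apply, linearSubst, MvPolynomial.aeval_X]
    conv_lhs => rw [← sum_smul_columnVector e hp i]
    simp only [map_sum, map_smul, ← columnBasis_apply e hp,
      SymmetricAlgebra.equivMvPolynomial_ι_apply]
  exact DFunLike.congr_fun h f

end Substitution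

/-! ### The canonical extension as an extremal seminorm -/

section CanonicalExtension

variable {K : Type*} [NontriviallyNormedField K] [IsUltrametricDist K] [ProperSpace K]
  {V : Type*} [AddCommGroup V] [Module K V] [FiniteDimensional K V]

lemma exists_isCanonical (γ : VectorSeminorm K V) :
    ∃ b : Module.Basis (Fin (Module.finrank K V)) K V, γ.IsCanonical b := by
  obtain ⟨p, hp, h⟩ := exists_isCanonical_columnBasis γ (Module.finBasis K V)
  exact ⟨_, h⟩

/-- The canonical extension of a seminorm to `Sym V`: its Gauss extension with respect to any
basis for which it is canonical. -/
def canonicalExtension (γ : VectorSeminorm K V) : PolySeminorm K V :=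
  gaussSeminorm γ (exists_isCanonical γ).choose

lemma restrict_canonicalExtension (γ : VectorSeminorm K V) : (canonicalExtension γ).restrict = γ :=
  (exists_isCanonical γ).choose_spec.restrict_gaussSeminorm

lemma canonicalExtension_le (γ : VectorSeminorm K V) {κ : Type*} [Fintype κ]
    (b : Module.Basis κ K V) (f : SymmetricAlgebra K V) :
    canonicalExtension γ f ≤ gaussExtension γ b f :=
  (exists_isCanonical γ).choose_spec.gaussExtension_le b f

lemma canonicalExtension_apply {γ : VectorSeminorm K V} {κ : Type*} [Fintype κ] [LinearOrder κ]
    {b : Module.Basis κ K V} (h : γ.IsCanonical b) (f : SymmetricAlgebra K V) :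
    canonicalExtension γ f = gaussExtension γ b f :=
  le_antisymm (canonicalExtension_le γ b f) (h.gaussExtension_le _ f)

/-- The canonical extension is the largest multiplicative seminorm with given restriction. -/
lemma PolySeminorm.le_canonicalExtension (α : PolySeminorm K V) (f : SymmetricAlgebra K V) :
    α f ≤ canonicalExtension α.restrict f :=
  α.le_gaussExtension (fun _ => le_rfl) _ f

/-- A basis canonical for `δ` is canonical for its multiple `γ`, and scaling all radii by `c` scales
a Gauss norm in degree `d` by `c ^ d`. This makes j well defined on classes. -/
lemma canonicalExtension_of_isHomogeneous {γ δ : VectorSeminorm K V} {c : ℝ≥0}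
    (h : ∀ v, γ v = c * δ v) {d : ℕ} {f : SymmetricAlgebra K V} (hf : IsHomogeneous f d) :
    canonicalExtension γ f = c ^ d * canonicalExtension δ f := by
  obtain ⟨b, hb⟩ := exists_isCanonical δ
  have hb' : γ.IsCanonical b := fun a => by
    rw [h, hb, NNReal.mul_finset_sup]
    refine Finset.sup_congr rfl fun i _ => ?_
    rw [h]
    ring
  rw [canonicalExtension_apply hb, canonicalExtension_apply hb', gaussExtension_eq,
    gaussExtension_eq, ← gaussNorm_smul_of_isHomogeneous (hf.equivMvPolynomial b)]
  simp only [h]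

/-- Maximality among extensions gives one inequality for every `g`; the reverse one comes from
applying it to `g⁻¹` and `g • γ`. -/
lemma canonicalExtension_smul (g : V ≃ₗ[K] V) (γ : VectorSeminorm K V) :
    canonicalExtension (g • γ) = g • canonicalExtension γ := by
  have key (g : V ≃ₗ[K] V) (γ : VectorSeminorm K V) (f : SymmetricAlgebra K V) :
      (g • canonicalExtension γ) f ≤ canonicalExtension (g • γ) f := by
    have := (g • canonicalExtension γ).le_canonicalExtension f
    rwa [restrict_smul, restrict_canonicalExtension] at this
  refine PolySeminorm.ext fun f => le_antisymm ?_ (key g γ f)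
  have h := key g⁻¹ (g • γ) (symMap (g⁻¹ : V ≃ₗ[K] V).toLinearMap f)
  rw [inv_smul_smul, ← PolySeminorm.smul_apply, ← PolySeminorm.smul_apply, smul_inv_smul] at h
  exact h

/-- The choice of canonical basis, which depends on `γ`, is traded for an infimum over a fixed
compact set, attained at any canonical integral basis. Continuity in `γ` follows. -/
lemma canonicalExtension_eq_sInf (γ : VectorSeminorm K V) (f : SymmetricAlgebra K V) :
    canonicalExtension γ f = sInf ((fun p : Matrix _ _ K × Matrix _ _ K =>
      gaussNorm (fun j => γ (columnVector (Module.finBasis K V) p.1 j))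
        (linearSubst p.2 (SymmetricAlgebra.equivMvPolynomial (Module.finBasis K V) f))) ''
          integralGL K (Fin (Module.finrank K V))) := by
  have heq {p} (hp : p ∈ integralGL K (Fin (Module.finrank K V))) :
      gaussNorm (fun j => γ (columnVector (Module.finBasis K V) p.1 j))
        (linearSubst p.2 (SymmetricAlgebra.equivMvPolynomial (Module.finBasis K V) f)) =
      gaussExtension γ (columnBasis (Module.finBasis K V) hp) f := by
    rw [gaussExtension_eq, equivMvPolynomial_columnBasis]
    simp only [columnBasis_apply]
  refine (IsLeast.csInf_eq ⟨?_, ?_⟩).symm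
  · obtain ⟨p, hp, h⟩ := exists_isCanonical_columnBasis γ (Module.finBasis K V)
    exact ⟨p, hp, (heq hp).trans (canonicalExtension_apply h f).symm⟩
  · rintro _ ⟨p, hp, rfl⟩
    exact (canonicalExtension_le γ _ f).trans (heq hp).ge

lemma continuous_canonicalExtension_apply (f : SymmetricAlgebra K V) :
    Continuous fun γ : VectorSeminorm K V => canonicalExtension γ f := by
  simp only [canonicalExtension_eq_sInf]
  exact isCompact_integralGL.continuous_sInf (continuous_gaussNorm_linearSubst _ _)

lemma continuous_canonicalExtension :
    Continuous (canonicalExtension : VectorSeminorm K V → PolySeminorm K V) :=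
  continuous_induced_rng.2 (continuous_pi continuous_canonicalExtension_apply)

/-! ### The section of the reduction map and its closed image -/

variable (K V)

/-- The section `j : X̄ → ℙ(V)^an` of the reduction map. -/
def reductionSection : XBar K V → PAn K V :=
  Quotient.map canonicalExtension (by
    rintro γ δ ⟨c, hc, h⟩
    exact ⟨c, hc, fun d f hf => canonicalExtension_of_isHomogeneous h hf⟩)

variable {K V}

lemma reductionSection_mk (γ : VectorSeminorm K V) :
    reductionSection K V (XBar.mk γ) = PAn.mk (canonicalExtension γ) := rfl

lemma continuous_reductionSection : Continuous (reductionSection K V) :=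
  continuous_canonicalExtension.quotient_map' _

lemma reductionSection_smul (g : PGL K V) (x : XBar K V) :
    reductionSection K V (g • x) = g • reductionSection K V x := by
  induction g using QuotientGroup.induction_on with
  | H g =>
    induction x using Quotient.inductionOn with
    | h γ => exact congrArg PAn.mk (canonicalExtension_smul g γ)

lemma reductionMap_reductionSection (x : XBar K V) :
    reductionMap K V (reductionSection K V x) = x := by
  induction x using Quotient.inductionOn with
  | h γ => exact congrArg XBar.mk (restrict_canonicalExtension γ)

/-- A point lies in the image of the section iff it is represented by `α` agreeing with the
canonical extension of `α|_V` on homogeneous elements. -/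
lemma mk_mem_range_reductionSection {α : PolySeminorm K V} :
    PAn.mk α ∈ Set.range (reductionSection K V) ↔ ∀ (d : ℕ) (f : SymmetricAlgebra K V),
      IsHomogeneous f d → α f = canonicalExtension α.restrict f := by
  constructor
  · rintro ⟨x, hx⟩
    have h1 : x = XBar.mk α.restrict := by
      rw [← reductionMap_reductionSection x, hx, reductionMap_mk]
    rw [h1, reductionSection_mk] at hx
    obtain ⟨c, hc, h⟩ := Quotient.exact hx
    obtain ⟨v, hv⟩ := α.exists_ne_zero'
    have hcv := h 1 _ (isHomogeneous_ι v)
    rw [← PolySeminorm.restrict_apply, restrict_canonicalExtension, PolySeminorm.restrict_apply,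
      pow_one] at hcv
    -- Both seminorms agree on `V`, so a vector with nonzero value fixes the homothety factor.
    have hc1 : c = 1 := (mul_eq_right₀ hv).1 hcv.symm
    intro d f hf
    rw [h d f hf, hc1, one_pow, one_mul]
  · intro h
    exact ⟨XBar.mk α.restrict, Quotient.sound ⟨1, one_pos, fun d f hf => by
      rw [one_pow, one_mul, h d f hf]⟩⟩

/-- Closedness is checked upstairs on seminorms, where each defining equality compares two
continuous functions of `α`. -/
lemma isClosed_range_reductionSection : IsClosed (Set.range (reductionSection K V)) := by
  have hq : Topology.IsQuotientMap (PAn.mk : PolySeminorm K V → PAn K V) := isQuotientMap_quot_mk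
  rw [← hq.isClosed_preimage]
  have h : PAn.mk ⁻¹' Set.range (reductionSection K V) =
      ⋂ (d : ℕ) (f : SymmetricAlgebra K V) (_ : IsHomogeneous f d),
        {α : PolySeminorm K V | α f = canonicalExtension α.restrict f} := by
    ext α
    simp only [Set.mem_iInter]
    exact mk_mem_range_reductionSection
  rw [h]
  exact isClosed_iInter fun d => isClosed_iInter fun f => isClosed_iInter fun _ =>
    isClosed_eq (continuous_polySeminorm_apply f)
      ((continuous_canonicalExtension_apply f).comp continuous_restrict)

end CanonicalExtension

end SeminormCompactification

end

open SeminormCompactification in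
theorem proposition6p1 {K : Type*} [NontriviallyNormedField K] [IsUltrametricDist K]
    [ProperSpace K] {V : Type*} [AddCommGroup V] [Module K V] [FiniteDimensional K V] :
    -- `r` is continuous and `PGL(V)`-equivariant
    Continuous (reductionMap K V) ∧
    (∀ (g : PGL K V) (x : PAn K V), reductionMap K V (g • x) = g • reductionMap K V x) ∧
    -- `r` extends the reduction maps of Berkovich on `Ω^an` and of Drinfeld on `Ω(K̄)`
    (∀ x : omegaAn K V, reductionMap K V (x : PAn K V) = (berkovichReduction x : XBar K V)) ∧
    (∀ x : omegaAlg K V, AlgPoint.toPAn (x : AlgPoint K V) ∈ omegaAn K V ∧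
      reductionMap K V (AlgPoint.toPAn (x : AlgPoint K V)) = (drinfeldReduction x : XBar K V)) ∧
    -- every seminorm is canonical with respect to some basis, and `j` is well defined
    (∀ γ : VectorSeminorm K V,
      ∃ b : Module.Basis (Fin (Module.finrank K V)) K V, γ.IsCanonical b) ∧
    ∃ j : XBar K V → PAn K V,
      (∀ (γ : VectorSeminorm K V) (b : Module.Basis (Fin (Module.finrank K V)) K V),
        γ.IsCanonical b → ∃ α : PolySeminorm K V,
          (∀ f, α f = gaussExtension γ b f) ∧ j (XBar.mk γ) = PAn.mk α) ∧
      -- `j` is continuous, equivariant, a section of `r`, and a homeomorphism onto a closed subset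
      Continuous j ∧
      (∀ (g : PGL K V) (x : XBar K V), j (g • x) = g • j x) ∧
      reductionMap K V ∘ j = id ∧
      Topology.IsEmbedding j ∧
      IsClosed (Set.range j) :=
  ⟨continuous_reductionMap, reductionMap_smul, reductionMap_eq_berkovichReduction,
    fun x => ⟨toPAn_mem_omegaAn x, reductionMap_eq_drinfeldReduction x⟩, exists_isCanonical,
    reductionSection K V,
    fun γ _ hb => ⟨canonicalExtension γ, canonicalExtension_apply hb, reductionSection_mk γ⟩,
    continuous_reductionSection, reductionSection_smul, funext reductionMap_reductionSection,
    Function.LeftInverse.isEmbedding reductionMap_reductionSection continuous_reductionMap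
      continuous_reductionSection,
    isClosed_range_reductionSection⟩
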